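/- Let $X\subset\mathbb{N}$, let $\hat\Sigma=X^{\mathbb{Z}}$ and $\Sigma=X^{\mathbb{Z}_{\ge 0}}$ carry the product topologies ($X$ discrete), with two-sided shift $\hat\sigma$ on $\hat\Sigma$ and one-sided shift $\sigma$ on $\Sigma$, and let $P:\hat\Sigma\to\Sigma$ be the projection that forgets the coordinates with negative index. Let $K$ be a compact metrizable space (for example a compact Riemannian manifold), $\hat M=\hat\Sigma\times K$ and $M=\Sigma\times K$. Let $\hat f:\hat M\to\hat M$ be a homeomorphism of the form $\hat f(\hat x,t)=(\hat\sigma(\hat x),f_{P(\hat x)}(t))$, so that the fibre maps depend only on $P(\hat x)$, and put $f(x,t)=(\sigma(x),f_x(t))$ on $M$. Let $\hat A:\hat M\to GL(d,\mathbb{C})$ be a continuous map of the form $\hat A=A\circ(P\times\operatorname{id}_K)$ with $A:M\to GL(d,\mathbb{C})$, and write $A^n(p)=A(f^{n-1}(p))\cdots A(f(p))A(p)$ for $p\in M$ and $n\ge 0$ (so $A^0(p)=\operatorname{id}$). Let $1\le l<d$, let $\operatorname{Grass}(l,d)$ be the Grassmannian of $l$-dimensional subspaces of $\mathbb{C}^d$,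 and let $\hat F(\hat q,V)=(\hat f(\hat q),\hat A(\hat q)V)$ on $\hat M\times\operatorname{Grass}(l,d)$. Let $\hat\mu$ be an $\hat f$-invariant Borel probability measure on $\hat M$, and let $\hat m$ be an $\hat F$-invariant Borel probability measure on $\hat M\times\operatorname{Grass}(l,d)$ that projects to $\hat\mu$ under $(\hat q,V)\mapsto\hat q$. Put $m=(P\times\operatorname{id}_K\times\operatorname{id}_{\operatorname{Grass}(l,d)})_*\hat m$. Let $\{\hat m_{\hat q}:\hat q\in\hat M\}$ and $\{m_q:q\in M\}$ be any disintegrations of $\hat m$ and of $m$ into (measurably varying) probability measures on $\operatorname{Grass}(l,d)$ along the fibres $\{\hat q\}\times\operatorname{Grass}(l,d)$ and $\{q\}\times\operatorname{Grass}(l,d)$. For $\hat q\in\hat M$ and $n\ge 0$ let $q_n=(P\times\operatorname{id}_K)(\hat f^{-n}(\hat q))$. Then for $\hat\mu$-almost every $\hat q\in\hat M$ the sequence of push-forwards $\big(A^n(q_n)_*m_{q_n}\big)_{n\ge 0}$ converges to $\hat m_{\hat q}$ in the weak$^*$ topology, that is, for every continuous $\varphi:\operatorname{Grass}(l,d)\to\mathbb{R}$,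 $$\lim_{n\to\infty}\int\varphi\,d\big(A^n(q_n)_*m_{q_n}\big)=\int\varphi\,d\hat m_{\hat q}.$$ -/

import Mathlib

open MeasureTheory ProbabilityTheory Filter Topology

/-- The two-sided shift on sequences of symbols from the alphabet `X`. -/
def shiftTwo {X : Set ℕ} (x : ℤ → X) : ℤ → X := fun n => x (n + 1)

/-- The one-sided shift on sequences of symbols from the alphabet `X`. -/
def shiftOne {X : Set ℕ} (x : ℕ → X) : ℕ → X := fun n => x (n + 1)

/-- The projection `P` forgetting the coordinates with negative index. -/
def projOne {X : Set ℕ} (x : ℤ → X) : ℕ → X := fun n => x (n : ℤ)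

/-- The map `P × id` on a product with a second factor `K`. -/
def projBase {X : Set ℕ} {K : Type*} (q : (ℤ → X) × K) : (ℕ → X) × K := (projOne q.1, q.2)

/-- The one-sided skew product `(x, t) ↦ (σ x, f_x t)` with fibre maps `fib x = f_x`. -/
def skewOne {X : Set ℕ} {K : Type*} (fib : (ℕ → X) → K → K) (q : (ℕ → X) × K) : (ℕ → X) × K :=
  (shiftOne q.1, fib q.1 q.2)

/-- The iterated product `A(f^{n-1} y) ⋯ A(f y) A(y)`. -/
def cocycleIter {Y G : Type*} [Monoid G] (f : Y → Y) (A : Y → G) : ℕ → Y → G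
  | 0, _ => 1
  | n + 1, y => A (f^[n] y) * cocycleIter f A n y

/-- The Grassmannian of `l`-dimensional linear subspaces of `ℂ^d`. -/
def Grass (l d : ℕ) : Type :=
  {V : Submodule ℂ (EuclideanSpace ℂ (Fin d)) // Module.finrank ℂ V = l}

namespace Grass

/-- The usual topology of the Grassmannian: a subspace is identified with the orthogonal
projection onto it, and projections are compared in the operator norm. -/
noncomputable instance (l d : ℕ) : TopologicalSpace (Grass l d) :=
  TopologicalSpace.induced (fun V => V.1.starProjection) inferInstance

/-- The Borel sigma-algebra of the Grassmannian. -/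
noncomputable instance (l d : ℕ) : MeasurableSpace (Grass l d) := borel _

instance (l d : ℕ) : BorelSpace (Grass l d) := ⟨rfl⟩

lemma toEuclideanLin_injective {d : ℕ} (g : GL (Fin d) ℂ) :
    Function.Injective (Matrix.toEuclideanLin (g : Matrix (Fin d) (Fin d) ℂ)) := by
  refine Function.LeftInverse.injective
    (g := Matrix.toEuclideanLin ((g⁻¹ : GL (Fin d) ℂ) : Matrix (Fin d) (Fin d) ℂ)) fun v => ?_
  have h : ((g⁻¹ : GL (Fin d) ℂ) : Matrix (Fin d) (Fin d) ℂ) * g = 1 := by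
    rw [← Units.val_mul, inv_mul_cancel, Units.val_one]
  ext i
  simp [Matrix.toLpLin_apply, Matrix.mulVec_mulVec, h, -Matrix.coe_units_inv]

/-- The action `V ↦ g V` of an invertible matrix on the Grassmannian. -/
noncomputable def act {l d : ℕ} (g : GL (Fin d) ℂ) (V : Grass l d) : Grass l d :=
  ⟨V.1.map (Matrix.toEuclideanLin (g : Matrix (Fin d) (Fin d) ℂ)),
    (LinearEquiv.finrank_eq (Submodule.equivMapOfInjective _ (toEuclideanLin_injective g) V.1)).symm.trans
      V.2⟩

end Grass

/-- The action `(q, V) ↦ (f q, A(q) V)` of a linear cocycle on the Grassmannian bundle. -/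
noncomputable def grassCocycle {Y : Type*} {d : ℕ} (l : ℕ) (f : Y → Y) (A : Y → GL (Fin d) ℂ)
    (q : Y × Grass l d) : Y × Grass l d :=
  (f q.1, Grass.act (A q.1) q.2)

/-!
The measures `A^n(q_n)_* m_{q_n}` disintegrate the image of `mhat` under `q ↦ q_n`: by invariance,
`mhat` is its own image under the `n`-th iterate of the cocycle, which carries the fibre over
`fhat^{-n}(q)` to the fibre over `q` by `A^n(q_n)`. Disintegrations along factors are conditional
expectations of the full disintegration. The `σ`-algebras generated by the maps `q ↦ q_n` increase
with `n`, and together they generate everything, since `q_n` remembers the coordinates of `q` from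
`-n` on. Lévy's upward theorem gives convergence for each test function, and a countable dense set
of test functions suffices.
-/

section FiberwiseMap

variable {Ω M Y Z : Type*} [MeasurableSpace Ω] [MeasurableSpace M] [MeasurableSpace Y]
  [MeasurableSpace Z]

/-- The kernel `x ↦ (T x)_* κ x`, moving each measure of a kernel by a map that depends on the base
point. As with `Kernel.map`, it is `0` unless `T` is jointly measurable. -/
noncomputable def fiberwiseMap (κ : Kernel M Y) (T : M → Y → Z) : Kernel M Z :=
  (Kernel.id ×ₖ κ).map (Function.uncurry T)

lemma fiberwiseMap_apply (κ : Kernel M Y) [IsSFiniteKernel κ] {T : M → Y → Z}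
    (hT : Measurable (Function.uncurry T)) (x : M) : fiberwiseMap κ T x = (κ x).map (T x) := by
  rw [fiberwiseMap, Kernel.map_apply _ hT, Kernel.prod_apply, Kernel.id_apply,
    Measure.dirac_prod, Measure.map_map hT measurable_prodMk_left]
  rfl

instance (κ : Kernel M Y) (T : M → Y → Z) : IsSFiniteKernel (fiberwiseMap κ T) := by
  unfold fiberwiseMap
  infer_instance

lemma isMarkovKernel_fiberwiseMap (κ : Kernel M Y) [IsMarkovKernel κ] {T : M → Y → Z}
    (hT : Measurable (Function.uncurry T)) : IsMarkovKernel (fiberwiseMap κ T) :=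
  Kernel.IsMarkovKernel.map _ hT

lemma isCondKernel_fiberwiseMap (ρ : Measure (M × Y)) [SFinite ρ] (κ : Kernel M Y)
    [IsSFiniteKernel κ] [ρ.IsCondKernel κ] {T : M → Y → Z} (hT : Measurable (Function.uncurry T)) :
    (ρ.map fun p => (p.1, T p.1 p.2)).IsCondKernel (fiberwiseMap κ T) := by
  have hΨ : Measurable fun p : M × Y => (p.1, T p.1 p.2) := measurable_fst.prodMk hT
  have hfst : (ρ.map fun p => (p.1, T p.1 p.2)).fst = ρ.fst := by
    rw [Measure.fst, Measure.map_map measurable_fst hΨ]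
    rfl
  refine ⟨Measure.ext fun s hs => ?_⟩
  calc ((ρ.map fun p => (p.1, T p.1 p.2)).fst ⊗ₘ fiberwiseMap κ T) s
      = ∫⁻ x, κ x (T x ⁻¹' (Prod.mk x ⁻¹' s)) ∂ρ.fst := by
        rw [hfst, Measure.compProd_apply hs]
        refine lintegral_congr fun x => ?_
        rw [fiberwiseMap_apply κ hT,
          Measure.map_apply hT.of_uncurry_left (measurable_prodMk_left hs)]
    _ = (ρ.fst ⊗ₘ κ) ((fun p => (p.1, T p.1 p.2)) ⁻¹' s) :=
        (Measure.compProd_apply (hΨ hs)).symm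
    _ = (ρ.map fun p => (p.1, T p.1 p.2)) s := by
        rw [ρ.disintegrate κ, Measure.map_apply hΨ hs]

lemma map_prodMap_comp_leftInverse {S R : Ω → Ω} (hRS : Function.LeftInverse R S)
    (hR : Measurable R) {π : Ω → M} (hπ : Measurable π) {T : M → Y → Y}
    (hT : Measurable (Function.uncurry T)) {m : Measure (Ω × Y)}
    (hm : MeasurePreserving (fun p => (S p.1, T (π p.1) p.2)) m m) :
    m.map (Prod.map (π ∘ R) id) =
      (m.map (Prod.map π id)).map fun p => (p.1, T p.1 p.2) := by
  have hΨ : Measurable fun p : M × Y => (p.1, T p.1 p.2) := measurable_fst.prodMk hT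
  conv_lhs => rw [← hm.map_eq]
  rw [Measure.map_map ((hπ.comp hR).prodMap measurable_id) hm.measurable,
    Measure.map_map hΨ (hπ.prodMap measurable_id)]
  congr 1
  ext1 p
  simp only [Function.comp_apply, Prod.map_apply, Prod.map_fst, Prod.map_snd, hRS p.1, id_eq]

lemma isCondKernel_fiberwiseMap_comp_leftInverse {S R : Ω → Ω} (hRS : Function.LeftInverse R S)
    (hR : Measurable R) {π : Ω → M} (hπ : Measurable π) {T : M → Y → Y}
    (hT : Measurable (Function.uncurry T)) {m : Measure (Ω × Y)} [SFinite m]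
    (hm : MeasurePreserving (fun p => (S p.1, T (π p.1) p.2)) m m)
    (κ : Kernel M Y) [IsSFiniteKernel κ] [(m.map (Prod.map π id)).IsCondKernel κ] :
    (m.map (Prod.map (π ∘ R) id)).IsCondKernel (fiberwiseMap κ T) := by
  rw [map_prodMap_comp_leftInverse hRS hR hπ hT hm]
  exact isCondKernel_fiberwiseMap _ κ hT

end FiberwiseMap

section FactorDisintegration

variable {Ω Y : Type*} [MeasurableSpace Ω] [MeasurableSpace Y]

section NormedSpace

variable {M E : Type*} [MeasurableSpace M] [NormedAddCommGroup E]

lemma integrable_comp_snd_compProd (m : Measure (Ω × Y)) (κ : Kernel Ω Y) [m.IsCondKernel κ]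
    {φ : Y → E} (hφ : Integrable φ m.snd) :
    Integrable (fun p : Ω × Y => φ p.2) (m.fst ⊗ₘ κ) := by
  rw [m.disintegrate κ]
  exact hφ.comp_measurable measurable_snd

variable [NormedSpace ℝ E]

lemma integrable_integral_condKernel (m : Measure (Ω × Y)) [SFinite m] (κ : Kernel Ω Y)
    [IsSFiniteKernel κ] [m.IsCondKernel κ] {φ : Y → E} (hφ : Integrable φ m.snd) :
    Integrable (fun q => ∫ y, φ y ∂κ q) m.fst :=
  Integrable.integral_compProd (κ := Kernel.const Unit m.fst) (η := Kernel.prodMkLeft Unit κ)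
    (a := ()) (integrable_comp_snd_compProd m κ hφ)

lemma setIntegral_integral_condKernel (m : Measure (Ω × Y)) [SFinite m] (κ : Kernel Ω Y)
    [IsSFiniteKernel κ] [m.IsCondKernel κ] {φ : Y → E} (hφ : Integrable φ m.snd)
    {s : Set Ω} (hs : MeasurableSet s) :
    ∫ q in s, ∫ y, φ y ∂κ q ∂m.fst = ∫ p in Prod.fst ⁻¹' s, φ p.2 ∂m := by
  have h := Measure.setIntegral_compProd hs MeasurableSet.univ
    (integrable_comp_snd_compProd m κ hφ).integrableOn
  simpa only [m.disintegrate κ, Set.prod_univ, Measure.restrict_univ] using h.symm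

theorem condExp_comap_integral_condKernel [CompleteSpace E] (m : Measure (Ω × Y))
    [IsFiniteMeasure m] (κ : Kernel Ω Y) [IsSFiniteKernel κ] [m.IsCondKernel κ] {π : Ω → M}
    (hπ : Measurable π) (η : Kernel M Y) [IsSFiniteKernel η]
    [(m.map (Prod.map π id)).IsCondKernel η] {φ : Y → E} (hφ : Integrable φ m.snd) :
    m.fst[fun q => ∫ y, φ y ∂κ q | MeasurableSpace.comap π inferInstance] =ᵐ[m.fst]
      fun q => ∫ y, φ y ∂η (π q) := by
  have hπid : Measurable (Prod.map π (id : Y → Y)) := hπ.prodMap measurable_id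
  have hfst : (m.map (Prod.map π id)).fst = m.fst.map π := by
    rw [Measure.fst, Measure.fst, Measure.map_map measurable_fst hπid,
      Measure.map_map hπ measurable_fst]
    rfl
  have hsnd : (m.map (Prod.map π id)).snd = m.snd := by
    rw [Measure.snd, Measure.map_map measurable_snd hπid]
    rfl
  have hη : Integrable (fun x => ∫ y, φ y ∂η x) (m.fst.map π) :=
    hfst ▸ integrable_integral_condKernel _ η (hsnd ▸ hφ)
  symm
  refine ae_eq_condExp_of_forall_setIntegral_eq hπ.comap_le
    (integrable_integral_condKernel m κ hφ) (fun _ _ _ => (hη.comp_measurable hπ).integrableOn) ?_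
    ⟨_, hη.1.stronglyMeasurable_mk.comp_measurable (comap_measurable π),
      ae_of_ae_map hπ.aemeasurable hη.1.ae_eq_mk⟩
  rintro _ ⟨B, hB, rfl⟩ -
  calc ∫ q in π ⁻¹' B, ∫ y, φ y ∂η (π q) ∂m.fst
      = ∫ x in B, ∫ y, φ y ∂η x ∂(m.map (Prod.map π id)).fst := by
        rw [hfst, setIntegral_map hB hη.1 hπ.aemeasurable]
    _ = ∫ p in Prod.fst ⁻¹' B, φ p.2 ∂m.map (Prod.map π id) :=
        setIntegral_integral_condKernel _ η (hsnd ▸ hφ) hB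
    _ = ∫ p in Prod.fst ⁻¹' (π ⁻¹' B), φ p.2 ∂m :=
        setIntegral_map (measurable_fst hB)
          ((hsnd ▸ hφ : Integrable φ (m.map (Prod.map π id)).snd).comp_measurable measurable_snd).1
          hπid.aemeasurable
    _ = ∫ q in π ⁻¹' B, ∫ y, φ y ∂κ q ∂m.fst :=
        (setIntegral_integral_condKernel m κ hφ (hπ hB)).symm

end NormedSpace

variable {M : ℕ → Type*} [∀ n, MeasurableSpace (M n)]

theorem ae_tendsto_integral_condKernel (m : Measure (Ω × Y)) [IsFiniteMeasure m]
    (κ : Kernel Ω Y) [IsSFiniteKernel κ] [m.IsCondKernel κ]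
    {π : ∀ n, Ω → M n} (hπ : ∀ n, Measurable (π n))
    (hmono : Monotone fun n => MeasurableSpace.comap (π n) inferInstance)
    (hgen : ‹MeasurableSpace Ω› ≤ ⨆ n, MeasurableSpace.comap (π n) inferInstance)
    (η : ∀ n, Kernel (M n) Y) [∀ n, IsSFiniteKernel (η n)]
    [∀ n, (m.map (Prod.map (π n) id)).IsCondKernel (η n)] {φ : Y → ℝ} (hφ : Integrable φ m.snd) :
    ∀ᵐ q ∂m.fst, Tendsto (fun n => ∫ y, φ y ∂η n (π n q)) atTop (𝓝 (∫ y, φ y ∂κ q)) := by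
  let ℱ : Filtration ℕ ‹MeasurableSpace Ω› :=
    ⟨fun n => MeasurableSpace.comap (π n) inferInstance, hmono, fun n => (hπ n).comap_le⟩
  have hsup : ⨆ n, ℱ n = ‹MeasurableSpace Ω› := le_antisymm (iSup_le ℱ.le) hgen
  have hlim : m.fst[fun q => ∫ y, φ y ∂κ q | ⨆ n, ℱ n] =ᵐ[m.fst] fun q => ∫ y, φ y ∂κ q := by
    have hint := integrable_integral_condKernel m κ hφ
    exact condExp_of_aestronglyMeasurable' hsup.le (by rw [hsup]; exact hint.1) hint
  filter_upwards [tendsto_ae_condExp (ℱ := ℱ) (μ := m.fst) fun q => ∫ y, φ y ∂κ q, hlim,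
    ae_all_iff.2 fun n => condExp_comap_integral_condKernel m κ (hπ n) (η n) hφ] with q hq hqκ hqη
  rw [← hqκ]
  exact hq.congr hqη

end FactorDisintegration

section WeakConvergence

variable {Ω Y : Type*} [MeasurableSpace Ω] [TopologicalSpace Y] [CompactSpace Y]
  [MeasurableSpace Y]

lemma integrable_continuousMap [OpensMeasurableSpace Y] (μ : Measure Y) [IsFiniteMeasure μ]
    (φ : C(Y, ℝ)) : Integrable φ μ :=
  (BoundedContinuousFunction.mkOfCompact φ).integrable μ

lemma lipschitzWith_integral_continuousMap [OpensMeasurableSpace Y] (μ : Measure Y)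
    [IsProbabilityMeasure μ] : LipschitzWith 1 fun φ : C(Y, ℝ) => ∫ y, φ y ∂μ := by
  refine LipschitzWith.mk_one fun φ ψ => ?_
  rw [dist_eq_norm, dist_eq_norm,
    ← integral_sub (integrable_continuousMap μ φ) (integrable_continuousMap μ ψ)]
  exact (BoundedContinuousFunction.mkOfCompact (φ - ψ)).norm_integral_le_norm μ

variable [TopologicalSpace.MetrizableSpace Y] [OpensMeasurableSpace Y]

lemma ae_forall_tendsto_integral_continuousMap {μ : Measure Ω} {ι : Type*} {L : Filter ι}
    (ν : ι → Ω → Measure Y) [∀ i q, IsProbabilityMeasure (ν i q)]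
    (ρ : Ω → Measure Y) [∀ q, IsProbabilityMeasure (ρ q)]
    (h : ∀ φ : C(Y, ℝ), ∀ᵐ q ∂μ, Tendsto (fun i => ∫ y, φ y ∂ν i q) L (𝓝 (∫ y, φ y ∂ρ q))) :
    ∀ᵐ q ∂μ, ∀ φ : C(Y, ℝ), Tendsto (fun i => ∫ y, φ y ∂ν i q) L (𝓝 (∫ y, φ y ∂ρ q)) := by
  filter_upwards [ae_all_iff.2 fun k => h (TopologicalSpace.denseSeq C(Y, ℝ) k)] with q hq φ
  refine (TopologicalSpace.denseRange_denseSeq C(Y, ℝ)).induction_on φ ?_ hq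
  exact Equicontinuous.isClosed_setOfPred_tendsto
    (LipschitzWith.uniformEquicontinuous _ 1
      fun i => lipschitzWith_integral_continuousMap (ν i q)).equicontinuous
    (lipschitzWith_integral_continuousMap (ρ q)).continuous

theorem ae_forall_tendsto_integral_condKernel (m : Measure (Ω × Y)) [IsFiniteMeasure m]
    (κ : Kernel Ω Y) [IsMarkovKernel κ] [m.IsCondKernel κ]
    {M : ℕ → Type*} [∀ n, MeasurableSpace (M n)] {π : ∀ n, Ω → M n} (hπ : ∀ n, Measurable (π n))
    (hmono : Monotone fun n => MeasurableSpace.comap (π n) inferInstance)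
    (hgen : ‹MeasurableSpace Ω› ≤ ⨆ n, MeasurableSpace.comap (π n) inferInstance)
    (η : ∀ n, Kernel (M n) Y) [∀ n, IsMarkovKernel (η n)]
    [∀ n, (m.map (Prod.map (π n) id)).IsCondKernel (η n)] :
    ∀ᵐ q ∂m.fst, ∀ φ : C(Y, ℝ),
      Tendsto (fun n => ∫ y, φ y ∂η n (π n q)) atTop (𝓝 (∫ y, φ y ∂κ q)) :=
  ae_forall_tendsto_integral_continuousMap (fun n q => η n (π n q)) (fun q => κ q) fun φ =>
    ae_tendsto_integral_condKernel m κ hπ hmono hgen η (integrable_continuousMap m.snd φ)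

end WeakConvergence

lemma trace_starProjection {𝕜 E : Type*} [RCLike 𝕜] [NormedAddCommGroup E] [InnerProductSpace 𝕜 E]
    [FiniteDimensional 𝕜 E] (V : Submodule 𝕜 E) :
    LinearMap.trace 𝕜 E V.starProjection = Module.finrank 𝕜 V :=
  LinearMap.IsProj.trace (p := V)
    ⟨V.starProjection_apply_mem, fun _ hx => Submodule.starProjection_eq_self_iff.2 hx⟩

namespace Grass

variable {l d : ℕ}

lemma isEmbedding_starProjection : IsEmbedding fun V : Grass l d => V.1.starProjection :=
  ⟨⟨rfl⟩, fun _ _ h => Subtype.ext (Submodule.starProjection_inj.1 h)⟩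

instance : TopologicalSpace.MetrizableSpace (Grass l d) :=
  isEmbedding_starProjection.metrizableSpace

lemma range_starProjection :
    Set.range (fun V : Grass l d => V.1.starProjection) =
      {p | IsStarProjection p ∧
        LinearMap.trace ℂ (EuclideanSpace ℂ (Fin d)) p.toLinearMap = l} := by
  ext p
  constructor
  · rintro ⟨V, rfl⟩
    exact ⟨isStarProjection_starProjection, by rw [trace_starProjection, V.2]⟩
  · rintro ⟨hp, htrace⟩
    obtain ⟨V, _, rfl⟩ := isStarProjection_iff_eq_starProjection.1 hp
    exact ⟨⟨V, by exact_mod_cast (trace_starProjection V).symm.trans htrace⟩, rfl⟩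

lemma isClosed_range_starProjection :
    IsClosed (Set.range fun V : Grass l d => V.1.starProjection) := by
  have htrace : Continuous fun p : EuclideanSpace ℂ (Fin d) →L[ℂ] EuclideanSpace ℂ (Fin d) =>
      LinearMap.trace ℂ (EuclideanSpace ℂ (Fin d)) p.toLinearMap :=
    ((LinearMap.trace ℂ (EuclideanSpace ℂ (Fin d))).comp
      (ContinuousLinearMap.coeLM ℂ)).continuous_of_finiteDimensional
  simp only [range_starProjection, isStarProjection_iff, IsIdempotentElem, IsSelfAdjoint]
  exact ((isClosed_eq (continuous_id.mul continuous_id) continuous_id).inter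
    (isClosed_eq continuous_star continuous_id)).inter (isClosed_eq htrace continuous_const)

instance : CompactSpace (Grass l d) := by
  rw [← isCompact_univ_iff, isEmbedding_starProjection.isCompact_iff, Set.image_univ]
  refine Metric.isCompact_of_isClosed_isBounded isClosed_range_starProjection
    (isBounded_iff_forall_norm_le.2 ⟨1, ?_⟩)
  rintro _ ⟨V, rfl⟩
  exact V.1.starProjection_norm_le

lemma act_one (V : Grass l d) : act 1 V = V := by
  apply Subtype.ext
  simp [act]

lemma act_mul (g h : GL (Fin d) ℂ) (V : Grass l d) : act (g * h) V = act g (act h V) := by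
  apply Subtype.ext
  simp only [act, Units.val_mul, ← Submodule.map_comp, Matrix.toLpLin_mul_same]

end Grass

section Cocycle

variable {Ω M : Type*} {f : M → M}

lemma cocycleIter_comp {G : Type*} [Monoid G] {e : Ω → Ω} {π : Ω → M}
    (h : Function.Semiconj π e f) (A : M → G) (n : ℕ) (q : Ω) :
    cocycleIter e (A ∘ π) n q = cocycleIter f A n (π q) := by
  induction n with
  | zero => rfl
  | succ n ih => simp only [cocycleIter, ih, Function.comp_apply, (h.iterate_right n).eq]

variable {l d : ℕ}

lemma grassCocycle_iterate (f : M → M) (A : M → GL (Fin d) ℂ) (n : ℕ) (p : M × Grass l d) :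
    (grassCocycle l f A)^[n] p = (f^[n] p.1, Grass.act (cocycleIter f A n p.1) p.2) := by
  induction n with
  | zero => simp only [Function.iterate_zero, id_eq, cocycleIter, Grass.act_one]
  | succ n ih =>
    simp only [Function.iterate_succ_apply', ih, grassCocycle, cocycleIter, Grass.act_mul]

lemma semiconj_grassCocycle {e : Ω → Ω} {π : Ω → M} (h : Function.Semiconj π e f)
    (A : M → GL (Fin d) ℂ) :
    Function.Semiconj (Prod.map π id) (grassCocycle l e (A ∘ π)) (grassCocycle l f A) :=
  fun p => Prod.ext (h p.1) rfl

lemma measurable_act_cocycleIter [MeasurableSpace M] {A : M → GL (Fin d) ℂ}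
    (h : Measurable (grassCocycle l f A)) (n : ℕ) :
    Measurable (Function.uncurry fun x (V : Grass l d) => Grass.act (cocycleIter f A n x) V) := by
  convert measurable_snd.comp (h.iterate n) using 1
  ext1 p
  rw [Function.comp_apply, grassCocycle_iterate]
  rfl

lemma measurePreserving_act_cocycleIter [MeasurableSpace Ω] {e : Ω → Ω} {π : Ω → M}
    (h : Function.Semiconj π e f) {A : M → GL (Fin d) ℂ} {m : Measure (Ω × Grass l d)}
    (hm : MeasurePreserving (grassCocycle l e (A ∘ π)) m m) (n : ℕ) :
    MeasurePreserving (fun p => (e^[n] p.1, Grass.act (cocycleIter f A n (π p.1)) p.2)) m m := by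
  convert hm.iterate n using 1
  ext1 p
  rw [grassCocycle_iterate, cocycleIter_comp h]

end Cocycle

section Factor

variable {Ω M : Type*} [MeasurableSpace M] {π : Ω → M} {f : M → M}

lemma measurable_of_semiconj [MeasurableSpace Ω] {S : Ω → Ω} {s : M → Ω}
    (h : Function.Semiconj π S f) (hs : Function.RightInverse s π) (hπ : Measurable π)
    (hsm : Measurable s) (hS : Measurable S) : Measurable f := by
  convert hπ.comp (hS.comp hsm) using 1
  ext1 x
  simp only [Function.comp_apply, h.eq, hs x]

lemma monotone_comap_comp_symm_iterate (e : Ω ≃ Ω) (h : Function.Semiconj π e f)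
    (hf : Measurable f) :
    Monotone fun n : ℕ => MeasurableSpace.comap (π ∘ e.symm^[n]) inferInstance := by
  refine monotone_nat_of_le_succ fun n => ?_
  have hn : π ∘ e.symm^[n] = f ∘ π ∘ e.symm^[n + 1] := by
    ext1 q
    simp only [Function.comp_apply, Function.iterate_succ_apply', ← h.eq, e.apply_symm_apply]
  rw [hn, ← MeasurableSpace.comap_comp]
  exact MeasurableSpace.comap_mono hf.comap_le

end Factor

section Shift

variable {X : Set ℕ} {K : Type*}

/-- A section of `projBase`, needed only to transfer measurability from the two-sided to the
one-sided system: the coordinates with negative index repeat the one of index `0`. -/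
def sectionBase (p : (ℕ → X) × K) : (ℤ → X) × K := (fun n => p.1 n.toNat, p.2)

lemma rightInverse_sectionBase :
    Function.RightInverse (sectionBase : (ℕ → X) × K → (ℤ → X) × K) projBase :=
  fun _ => rfl

lemma semiconj_projBase_skewOne {fhat : (ℤ → X) × K → (ℤ → X) × K} {fib : (ℕ → X) → K → K}
    (hf : ∀ (x : ℤ → X) (t : K), fhat (x, t) = (shiftTwo x, fib (projOne x) t)) :
    Function.Semiconj projBase fhat (skewOne fib) :=
  fun q => congrArg projBase (hf q.1 q.2)

lemma shiftTwo_iterate_apply (n : ℕ) (x : ℤ → X) (k : ℤ) : shiftTwo^[n] x k = x (k + n) := by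
  induction n generalizing k with
  | zero => simp only [Function.iterate_zero, id_eq, Nat.cast_zero, add_zero]
  | succ n ih =>
    rw [Function.iterate_succ_apply', shiftTwo, ih, Nat.cast_succ, add_assoc, add_comm 1]

lemma fst_symm_iterate_apply {e : ((ℤ → X) × K) ≃ ((ℤ → X) × K)}
    (he : Function.Semiconj Prod.fst e shiftTwo) (n : ℕ) (q : (ℤ → X) × K) (k : ℤ) :
    (e.symm^[n] q).1 k = q.1 (k - n) := by
  have h := congrFun ((he.iterate_right n).eq (e.symm^[n] q)) (k - n)
  rw [e.rightInverse_symm.iterate n q, shiftTwo_iterate_apply, sub_add_cancel] at h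
  exact h.symm

variable [MeasurableSpace K]

lemma measurable_projBase : Measurable (projBase : (ℤ → X) × K → (ℕ → X) × K) := by
  unfold projBase projOne
  fun_prop

lemma measurable_sectionBase : Measurable (sectionBase : (ℕ → X) × K → (ℤ → X) × K) := by
  unfold sectionBase
  fun_prop

lemma measurable_of_semiconj_projBase {S : (ℤ → X) × K → (ℤ → X) × K}
    {f : (ℕ → X) × K → (ℕ → X) × K} (h : Function.Semiconj projBase S f) (hS : Measurable S) :
    Measurable f :=
  measurable_of_semiconj h rightInverse_sectionBase measurable_projBase measurable_sectionBase hS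

lemma measurable_grassCocycle_of_semiconj_projBase {l d : ℕ} {S : (ℤ → X) × K → (ℤ → X) × K}
    {f : (ℕ → X) × K → (ℕ → X) × K} (h : Function.Semiconj projBase S f)
    {A : (ℕ → X) × K → GL (Fin d) ℂ} (hSA : Measurable (grassCocycle l S (A ∘ projBase))) :
    Measurable (grassCocycle l f A) :=
  measurable_of_semiconj (semiconj_grassCocycle h A)
    (rightInverse_sectionBase.prodMap fun _ => rfl) (measurable_projBase.prodMap measurable_id)
    (measurable_sectionBase.prodMap measurable_id) hSA

lemma le_iSup_comap_projBase_comp_symm_iterate {e : ((ℤ → X) × K) ≃ ((ℤ → X) × K)}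
    (he : Function.Semiconj Prod.fst e shiftTwo) :
    (inferInstance : MeasurableSpace ((ℤ → X) × K)) ≤
      ⨆ n : ℕ, MeasurableSpace.comap (projBase ∘ e.symm^[n]) inferInstance := by
  set 𝒢 : MeasurableSpace ((ℤ → X) × K) :=
    ⨆ n : ℕ, MeasurableSpace.comap (projBase ∘ e.symm^[n]) inferInstance
  have hpast (n : ℕ) : Measurable[𝒢] (projBase ∘ e.symm^[n]) :=
    measurable_iff_comap_le.2 (le_iSup (fun n : ℕ =>
      MeasurableSpace.comap (projBase ∘ e.symm^[n]) inferInstance) n)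
  have hcoord (k : ℤ) : Measurable[𝒢] fun q : (ℤ → X) × K => q.1 k := by
    -- the `k`-th coordinate of `q` is the one of index `k + |k| ≥ 0` after `|k|` steps back
    have h : (fun q : (ℤ → X) × K => q.1 k) =
        fun q => (projBase (e.symm^[k.natAbs] q)).1 (k + k.natAbs).toNat := by
      ext1 q
      simp only [projBase, projOne, fst_symm_iterate_apply he]
      rw [Int.toNat_of_nonneg (by omega), add_sub_cancel_right]
    rw [h]
    exact (measurable_pi_apply _).comp (measurable_fst.comp (hpast _))
  have hfst : Measurable[𝒢] (Prod.fst : (ℤ → X) × K → ℤ → X) := measurable_pi_iff.2 hcoord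
  have hsnd : Measurable[𝒢] (Prod.snd : (ℤ → X) × K → K) :=
    show Measurable[𝒢] (Prod.snd ∘ projBase ∘ e.symm^[0]) from measurable_snd.comp (hpast 0)
  exact sup_le hfst.comap_le hsnd.comap_le

end Shift

theorem propositionp_general {X : Set ℕ} {K : Type*} [MeasurableSpace K] {l d : ℕ}
    (fhat : ((ℤ → X) × K) ≃ᵐ ((ℤ → X) × K)) (fib : (ℕ → X) → K → K)
    (hf : ∀ (x : ℤ → X) (t : K), fhat (x, t) = (shiftTwo x, fib (projOne x) t))
    (A : (ℕ → X) × K → GL (Fin d) ℂ)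
    (mhat : Measure (((ℤ → X) × K) × Grass l d)) [IsFiniteMeasure mhat]
    (hm : MeasurePreserving (grassCocycle l fhat (A ∘ projBase)) mhat mhat)
    (mhatDis : Kernel ((ℤ → X) × K) (Grass l d)) [IsMarkovKernel mhatDis]
    [mhat.IsCondKernel mhatDis]
    (mDis : Kernel ((ℕ → X) × K) (Grass l d)) [IsMarkovKernel mDis]
    [(mhat.map (Prod.map projBase id)).IsCondKernel mDis] :
    ∀ᵐ q ∂mhat.fst, ∀ φ : C(Grass l d, ℝ),
      Tendsto
        (fun n : ℕ =>
          ∫ V, φ V ∂((mDis (projBase (fhat.symm^[n] q))).map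
            (Grass.act (cocycleIter (skewOne fib) A n (projBase (fhat.symm^[n] q))))))
        atTop (𝓝 (∫ V, φ V ∂(mhatDis q))) := by
  have hshift : Function.Semiconj Prod.fst fhat shiftTwo :=
    fun q => congrArg Prod.fst (hf q.1 q.2)
  have hsemi : Function.Semiconj projBase fhat (skewOne fib) := semiconj_projBase_skewOne hf
  have hact := measurable_act_cocycleIter (measurable_grassCocycle_of_semiconj_projBase hsemi
    hm.measurable)
  have hpast (n : ℕ) : Measurable fhat.symm^[n] := fhat.symm.measurable.iterate n
  let η (n : ℕ) : Kernel ((ℕ → X) × K) (Grass l d) :=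
    fiberwiseMap mDis fun x => Grass.act (cocycleIter (skewOne fib) A n x)
  have hMarkov (n : ℕ) : IsMarkovKernel (η n) := isMarkovKernel_fiberwiseMap mDis (hact n)
  have hcond (n : ℕ) : (mhat.map (Prod.map (projBase ∘ fhat.symm^[n]) id)).IsCondKernel (η n) :=
    isCondKernel_fiberwiseMap_comp_leftInverse
      (fhat.toEquiv.leftInverse_symm.iterate n) (hpast n) measurable_projBase (hact n)
      (measurePreserving_act_cocycleIter hsemi hm n) mDis
  filter_upwards [ae_forall_tendsto_integral_condKernel mhat mhatDis
    (fun n => measurable_projBase.comp (hpast n))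
    (monotone_comap_comp_symm_iterate fhat.toEquiv hsemi
      (measurable_of_semiconj_projBase hsemi fhat.measurable))
    (le_iSup_comap_projBase_comp_symm_iterate (e := fhat.toEquiv) hshift) η] with q hq φ
  simpa only [η, Function.comp_apply, fiberwiseMap_apply mDis (hact _)] using hq φ

theorem propositionp
    {X : Set ℕ}
    {K : Type*} [TopologicalSpace K] [CompactSpace K] [TopologicalSpace.MetrizableSpace K]
    [MeasurableSpace K] [BorelSpace K]
    (l d : ℕ) (hl : 1 ≤ l) (hld : l < d)
    -- the skew product over the two-sided shift, with fibre maps depending only on `P x`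
    (fhat : ((ℤ → X) × K) ≃ₜ ((ℤ → X) × K))
    (fib : (ℕ → X) → K → K)
    (hf : ∀ (x : ℤ → X) (t : K), fhat (x, t) = (shiftTwo x, fib (projOne x) t))
    -- the linear cocycle, depending only on `(P x, t)`
    (Ahat : (ℤ → X) × K → GL (Fin d) ℂ) (hAcont : Continuous Ahat)
    (A : (ℕ → X) × K → GL (Fin d) ℂ) (hA : ∀ q, Ahat q = A (projBase q))
    -- the invariant measure on the base, and an invariant measure that projects to it
    (muhat : Measure ((ℤ → X) × K)) [IsProbabilityMeasure muhat]
    (hmu : MeasurePreserving fhat muhat muhat)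
    (mhat : Measure (((ℤ → X) × K) × Grass l d)) [IsProbabilityMeasure mhat]
    (hproj : mhat.map Prod.fst = muhat)
    (hm : MeasurePreserving (grassCocycle l fhat Ahat) mhat mhat)
    -- disintegrations of `mhat` and of its one-sided projection along the Grassmannian fibres
    (mhatDis : Kernel ((ℤ → X) × K) (Grass l d)) [IsMarkovKernel mhatDis]
    [mhat.IsCondKernel mhatDis]
    (mDis : Kernel ((ℕ → X) × K) (Grass l d)) [IsMarkovKernel mDis]
    [(mhat.map (Prod.map projBase id)).IsCondKernel mDis] :
    ∀ᵐ q ∂muhat, ∀ φ : C(Grass l d, ℝ),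
      Tendsto
        (fun n : ℕ =>
          ∫ V, φ V ∂((mDis (projBase (fhat.symm^[n] q))).map
            (Grass.act (cocycleIter (skewOne fib) A n (projBase (fhat.symm^[n] q))))))
        atTop (𝓝 (∫ V, φ V ∂(mhatDis q))) := by
  obtain rfl : Ahat = A ∘ projBase := funext hA
  exact hproj ▸ propositionp_general fhat.toMeasurableEquiv fib hf A mhat hm mhatDis mDis
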